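/- \textbf{Setting.} Consider a finite normal-form game with a finite non-empty set of players $i$, finite action sets $\mathcal A_i$ and payoff functions $u_i:\mathcal A=\prod_j\mathcal A_j\to\mathbb R$, extended multilinearly to $\mathcal X=\prod_i\mathcal X_i$, $\mathcal X_i=\Delta(\mathcal A_i)$. Let $v_i(x)=(u_i(a;x_{-i}))_{a\in\mathcal A_i}$ and $v=(v_i)_i$, and let $\mathcal Y=\prod_i\mathbb R^{\mathcal A_i}$. For non-empty $\mathcal B_i\subseteq\mathcal A_i$ let $\mathcal S=\prod_i\Delta(\mathcal B_i)\subseteq\mathcal X$ be the face spanned by $\prod_i\mathcal B_i$, and assume that $\mathcal S$ is closed under better replies (a club set): if $x\in\mathcal S$ and $x'\in\mathcal X$ satisfies $u_i(x'_i;x_{-i})\ge u_i(x)$ for every player $i$, then $x'\in\mathcal S$. Let $\theta:[0,1]\to\mathbb R$ be continuous, and twice differentiable on $(0,1]$ with $\inf_{(0,1]}\theta''>0$ (no steepness is required), and let $Q_i(y_i)=\arg\max_{x_i\in\mathcal X_i}\{\langle y_i,x_i\rangle-\sum_{a\in\mathcal A_i}\theta(x_{i,a})\}$ for $y_i \in \mathbb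 R^{\mathcal A_i}$. Let $\gamma_t=\gamma/t^{p}$ with $\gamma>0$, $p\in[0,1]$, and fix $b>0$, $0\le q<1/2$ and constants $K_b,K_u$. A sequence of play of regularized learning with these parameters is a process, on a probability space with a filtration $(\mathcal F_t)$, such that for all $t=1,2,\dots$ $$Y_{t+1}=Y_t+\gamma_t\hat v_t,\qquad X_{i,t}=Q_i(Y_{i,t})\ \text{ for all } i,$$ where $Y_t$ is $\mathcal F_t$-measurable with values in $\mathcal Y$, $\hat v_t$ is integrable, and, almost surely, $\|\mathbb E[\hat v_t\mid\mathcal F_t]-v(X_t)\|_\infty\le K_b/t^{b}$ and $\|\hat v_t-\mathbb E[\hat v_t\mid\mathcal F_t]\|_\infty\le K_u t^{q}$. \textbf{Theorem 3.} There are constants $C,c_2>0$ and $c_1\in\mathbb R$ such that for every $\delta>0$ there is an open unbounded set $\mathcal D\subseteq\mathcal Y$ of initial scores such that, for every sequence of play as above with $Y_1\in\mathcal D$ almost surely, $$\mathbb P\Bigl(\operatorname{dist}(X_t,\mathcal S)\le C\,\varphi\Bigl(c_1-c_2\sum_{s=1}^t\gamma_s\Bigr)\ \text{ for all } t=1,2,\dots\Bigr)\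 \ge\ 1-\delta,$$ where $\operatorname{dist}$ is the distance in the sup norm and the rate function $\varphi$ is given by $\varphi(z)=0$ if $z\le\lim_{s\to0^+}\theta'(s)$, $\varphi(z)=(\theta')^{-1}(z)$ if $\lim_{s\to0^+}\theta'(s)<z<\theta'(1)$, and $\varphi(z)=1$ if $z\ge\theta'(1)$. -/

import Mathlib

open MeasureTheory Filter Topology Set

namespace RegLearn

noncomputable section

section Game

variable {ι : Type*} [Fintype ι] [DecidableEq ι]
  {A : ι → Type*} [∀ i, Fintype (A i)] [∀ i, DecidableEq (A i)]

/-- The mixed extension `u_i(x) = ∑_α u_i(α) ∏_j x_{j α_j}` of the pure payoff functions `u`. -/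
def mixedPayoff (u : ι → (∀ j, A j) → ℝ) (i : ι) (x : ∀ j, A j → ℝ) : ℝ :=
  ∑ α : ∀ j, A j, u i α * ∏ j, x j (α j)

/-- The mixed payoff vectors `v_i(x) = (u_i(a; x_{-i}))_{a ∈ A_i}`, over all players `i`. -/
def payoffVec (u : ι → (∀ j, A j) → ℝ) (x : ∀ j, A j → ℝ) : ∀ j, A j → ℝ :=
  fun i a => mixedPayoff u i (Function.update x i (Pi.single a 1))

/-- The mixed strategies of player `i` that do weakly better against `x` than `x_i`. -/
def betterReplies (u : ι → (∀ j, A j) → ℝ) (i : ι) (x : ∀ j, A j → ℝ) : Set (A i → ℝ) :=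
  {x' | x' ∈ stdSimplex ℝ (A i) ∧ mixedPayoff u i x ≤ mixedPayoff u i (Function.update x i x')}

/-- The span (face of the strategy space) of the product `∏ B_i` of sets of pure strategies:
all profiles of mixed strategies `x_i` that are supported in `B_i`. -/
def face (B : ∀ i, Set (A i)) : Set (∀ j, A j → ℝ) :=
  {x | ∀ i, x i ∈ stdSimplex ℝ (A i) ∧ ∀ a, a ∉ B i → x i a = 0}

/-- `S` is closed under better replies ("club"): `btr(x) = ∏ btr_i(x) ⊆ S` for all `x ∈ S`. -/
def IsClub (u : ι → (∀ j, A j) → ℝ) (S : Set (∀ j, A j → ℝ)) : Prop :=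
  ∀ x ∈ S, ∀ x' : ∀ j, A j → ℝ, (∀ i, x' i ∈ betterReplies u i x) → x' ∈ S

end Game

section Regularizer

/-- The derivative `θ'` of `θ` on `(0,1]`, one-sided at `1`. -/
def kerDeriv (θ : ℝ → ℝ) : ℝ → ℝ := derivWithin θ (Ioc 0 1)

/-- `θ` is a regularizer kernel: continuous on `[0,1]`, twice differentiable on `(0,1]`, and
`inf_{z ∈ (0,1]} θ''(z) > 0`. -/
structure IsKernel (θ : ℝ → ℝ) : Prop where
  continuousOn : ContinuousOn θ (Icc 0 1)
  differentiableOn : DifferentiableOn ℝ θ (Ioc 0 1)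
  differentiableOn_deriv : DifferentiableOn ℝ (kerDeriv θ) (Ioc 0 1)
  strong : ∃ κ : ℝ, 0 < κ ∧ ∀ z ∈ Ioc (0 : ℝ) 1, κ ≤ derivWithin (kerDeriv θ) (Ioc 0 1) z

/-- The limit `θ'(0⁺) ∈ [-∞, ∞)`; since `θ'` is increasing, it is the infimum of `θ'` on `(0,1]`
(see `tendsto_kerDeriv`). -/
def slopeZero (θ : ℝ → ℝ) : EReal := ⨅ z : Ioc (0 : ℝ) 1, (kerDeriv θ z : EReal)

/-- The rate function: `0` for `z ≤ θ'(0⁺)`, `(θ')⁻¹(z)` for `θ'(0⁺) < z < θ'(1)`, and `1` for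
`z ≥ θ'(1)`. -/
def rate (θ : ℝ → ℝ) (z : ℝ) : ℝ :=
  open Classical in
  if (z : EReal) ≤ slopeZero θ then 0
  else if kerDeriv θ 1 ≤ z then 1
  else Function.invFunOn (kerDeriv θ) (Ioc 0 1) z

theorem IsKernel.strictMonoOn {θ : ℝ → ℝ} (h : IsKernel θ) :
    StrictMonoOn (kerDeriv θ) (Ioc 0 1) := by
  obtain ⟨κ, hκ, hk⟩ := h.strong
  refine strictMonoOn_of_deriv_pos (convex_Ioc 0 1) h.differentiableOn_deriv.continuousOn ?_
  intro z hz
  rw [interior_Ioc] at hz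
  rw [← derivWithin_of_mem_nhds (Ioc_mem_nhds hz.1 hz.2)]
  exact hκ.trans_le (hk z ⟨hz.1, hz.2.le⟩)

theorem tendsto_kerDeriv {θ : ℝ → ℝ} (h : IsKernel θ) :
    Tendsto (fun z => (kerDeriv θ z : EReal)) (𝓝[>] 0) (𝓝 (slopeZero θ)) := by
  refine tendsto_order.2 ⟨fun a ha => ?_, fun a ha => ?_⟩
  · filter_upwards [Ioc_mem_nhdsGT (zero_lt_one' ℝ)] with z hz
    exact ha.trans_le (iInf_le (fun z : Ioc (0 : ℝ) 1 => (kerDeriv θ z : EReal)) ⟨z, hz⟩)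
  · obtain ⟨⟨w, hw⟩, hwa⟩ := iInf_lt_iff.1 ha
    filter_upwards [Ioc_mem_nhdsGT hw.1] with z hz
    refine lt_of_le_of_lt (EReal.coe_le_coe_iff.2 ?_) hwa
    exact h.strictMonoOn.monotoneOn ⟨hz.1, hz.2.trans hw.2⟩ hw hz.2

/-- The regularized choice map of a player with action set `α`: the maximizers over the simplex
of `⟨y, x⟩ - ∑_a θ(x_a)`. -/
def choice {α : Type*} [Fintype α] (θ : ℝ → ℝ) (y : α → ℝ) : Set (α → ℝ) :=
  {x | x ∈ stdSimplex ℝ α ∧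
    IsMaxOn (fun x : α → ℝ => ∑ a, y a * x a - ∑ a, θ (x a)) (stdSimplex ℝ α) x}

end Regularizer

section Learning

/-- The step-size sequence `γ_t = γ / t^p`. -/
def stepSize (γ p : ℝ) (t : ℕ) : ℝ := γ / (t : ℝ) ^ p

variable {ι : Type*} [Fintype ι] [DecidableEq ι]
  {A : ι → Type*} [∀ i, Fintype (A i)] [∀ i, DecidableEq (A i)]
  {Ω : Type*} {m : MeasurableSpace Ω}

/-- `X` is a sequence of play generated by regularized learning at the stages `t = 1, 2, …`, with
scores `Y`, surrogate payoff vectors `V`, step sizes `γ / t^p`, offset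
`E[V_t | ℱ_t] - v(X_t)` bounded by `Kb / t^b` and random error `V_t - E[V_t | ℱ_t]` bounded by
`Ku * t^q`. (The norm is the sup norm over players and actions.) -/
structure IsLearning (u : ι → (∀ j, A j) → ℝ) (θ : ℝ → ℝ) (γ p Kb b Ku q : ℝ)
    (P : Measure Ω) (ℱ : Filtration ℕ m) (X Y V : ℕ → Ω → ∀ j, A j → ℝ) : Prop where
  adapted : ∀ t, 1 ≤ t → StronglyMeasurable[ℱ t] (Y t)
  integrable : ∀ t, 1 ≤ t → Integrable (V t) P
  aggregate : ∀ t, 1 ≤ t → ∀ ω, Y (t + 1) ω = Y t ω + stepSize γ p t • V t ω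
  respond : ∀ t, 1 ≤ t → ∀ ω i, X t ω i ∈ choice θ (Y t ω i)
  offset : ∀ t, 1 ≤ t → ∀ᵐ ω ∂P, ‖(P[V t | ℱ t]) ω - payoffVec u (X t ω)‖ ≤ Kb / (t : ℝ) ^ b
  noise : ∀ t, 1 ≤ t → ∀ᵐ ω ∂P, ‖V t ω - (P[V t | ℱ t]) ω‖ ≤ Ku * (t : ℝ) ^ q

end Learning

end

end RegLearn

/-! The proof tracks the score gaps `y a - y b` of an action `a` off the club face against an action
`b` on it. Three facts carry it.

Drift: at a profile on the face, actions off it pay strictly less than actions on it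
(`IsClub.payoffVec_lt`); by compactness the deficit is at least some `c > 0` while all off-face
masses stay below some `η` (`IsClub.exists_payoffVec_gap`). There, each gap falls by `c * γ_t` per
step, up to offset and noise.

Control of errors: the offset vanishes, so its sum is at most a constant plus `c/8` times the
accumulated step sizes. The noise is a martingale; divided by `M + (c/8) ∑ γ_s`, its increments are
of order `t^(q-1)`, square-summable because `q < 1/2`. Kolmogorov's inequality and summation by
parts then bound it for all times at once, and a large `M` makes the failure probability small.

Choice map: first-order optimality gives `θ'(x a) ≤ θ'(1) + (y a - y b)`, without steepness. A very
negative gap therefore keeps `x a ≤ η`, which preserves the drift: a strong induction closes the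
loop (`score_gap_le`). The same inequality turns the linear fall of the gaps into the rate. Only the
initial set depends on `δ`, through `M`. -/

namespace RegLearn

/-! ### Maximal inequality and summation by parts -/

section Martingale

variable {Ω : Type*} {m : MeasurableSpace Ω} {P : Measure Ω} [IsProbabilityMeasure P]

/-- Kolmogorov's maximal inequality for martingale differences with deterministic bounds. -/
theorem measure_exists_le_abs_sum_le {𝒢 : Filtration ℕ m} {D : ℕ → Ω → ℝ} {r : ℕ → ℝ}
    (hadp : ∀ n, StronglyMeasurable[𝒢 (n + 1)] (D n))
    (hr : ∀ n, ∀ᵐ ω ∂P, |D n ω| ≤ r n) (h0 : ∀ n, P[D n | 𝒢 n] =ᵐ[P] 0)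
    (hs : Summable fun n => r n ^ 2) {η : ℝ} (hη : 0 < η) :
    P {ω | ∃ n, η ≤ |∑ k ∈ Finset.range n, D k ω|} ≤
      ENNReal.ofReal ((∑' n, r n ^ 2) / η ^ 2) := by
  set W : ℕ → Ω → ℝ := fun n ω => ∑ k ∈ Finset.range n, D k ω with hW
  have hWmeas : ∀ n, StronglyMeasurable[𝒢 n] (W n) := by
    intro n
    refine Finset.stronglyMeasurable_fun_sum _ fun k hk => (hadp k).mono (𝒢.mono ?_)
    exact Finset.mem_range.1 hk
  have hWbd : ∀ n, ∀ᵐ ω ∂P, |W n ω| ≤ ∑ k ∈ Finset.range n, r k := by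
    intro n
    filter_upwards [ae_all_iff.2 hr] with ω hω
    exact (Finset.abs_sum_le_sum_abs _ _).trans (Finset.sum_le_sum fun k _ => hω k)
  have hDm : ∀ n, AEStronglyMeasurable (D n) P := fun n =>
    ((hadp n).mono (𝒢.le _)).aestronglyMeasurable
  have hWm : ∀ n, AEStronglyMeasurable (W n) P := fun n =>
    ((hWmeas n).mono (𝒢.le _)).aestronglyMeasurable
  have hDint : ∀ n, Integrable (D n) P := fun n =>
    Integrable.of_bound (hDm n) (r n) (hr n)
  have hWint : ∀ n, Integrable (W n) P := fun n =>
    Integrable.of_bound (hWm n) _ (hWbd n)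
  have hWDint : ∀ n, Integrable (W n * D n) P := fun n =>
    (hDint n).bdd_mul (hWm n) (hWbd n)
  have hD2int : ∀ n, Integrable (D n * D n) P := fun n =>
    (hDint n).bdd_mul (hDm n) (hr n)
  have hW2int : ∀ n, Integrable (W n * W n) P := fun n =>
    (hWint n).bdd_mul (hWm n) (hWbd n)
  -- Increments are orthogonal to the past, so the cross term drops out both from the submartingale
  -- property of `W ^ 2` and from its second moment.
  have hpull : ∀ n, P[W n * D n | 𝒢 n] =ᵐ[P] 0 := by
    intro n
    filter_upwards [condExp_mul_of_stronglyMeasurable_left (hWmeas n) (hWDint n) (hDint n),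
      h0 n] with ω h1 h2
    rw [h1, Pi.mul_apply, h2]; simp
  have hstep : ∀ n, W (n + 1) * W (n + 1) =
      W n * W n + ((2 : ℝ) • (W n * D n) + D n * D n) := by
    intro n; ext ω
    simp only [hW, Pi.mul_apply, Pi.add_apply, Pi.smul_apply, Finset.sum_range_succ, smul_eq_mul]
    ring
  have hsub : Submartingale (fun n => W n * W n) 𝒢 P := by
    refine submartingale_nat (fun n => (hWmeas n).mul (hWmeas n)) hW2int fun n => ?_
    rw [hstep n]
    have e1 := condExp_add (hW2int n) (((hWDint n).smul (2 : ℝ)).add (hD2int n)) (𝒢 n)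
    have e2 := condExp_add ((hWDint n).smul (2 : ℝ)) (hD2int n) (𝒢 n)
    have e3 := condExp_smul (μ := P) (2 : ℝ) (W n * D n) (𝒢 n)
    have e4 : 0 ≤ᵐ[P] P[D n * D n | 𝒢 n] :=
      condExp_nonneg (ae_of_all _ fun ω => mul_self_nonneg (D n ω))
    have e5 := condExp_of_stronglyMeasurable (𝒢.le n) ((hWmeas n).mul (hWmeas n)) (hW2int n)
    filter_upwards [e1, e2, e3, e4, hpull n] with ω a1 a2 a3 a4 a5
    rw [a1, Pi.add_apply, a2, Pi.add_apply, a3, Pi.smul_apply, a5, e5]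
    simpa using a4
  have hsecond : ∀ n, ∫ ω, (W n * W n) ω ∂P ≤ ∑ k ∈ Finset.range n, r k ^ 2 := by
    intro n
    induction n with
    | zero => simp [hW]
    | succ n ih =>
      rw [hstep n, integral_add' (hW2int n) (((hWDint n).smul (2 : ℝ)).add (hD2int n)),
        integral_add' ((hWDint n).smul (2 : ℝ)) (hD2int n), Finset.sum_range_succ]
      have z1 : ∫ ω, ((2 : ℝ) • (W n * D n)) ω ∂P = 0 := by
        simp only [Pi.smul_apply]
        rw [integral_smul, ← integral_condExp (𝒢.le n), integral_congr_ae (hpull n)]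
        simp
      have z2 : ∫ ω, (D n * D n) ω ∂P ≤ r n ^ 2 := by
        have : ∫ ω, (D n * D n) ω ∂P ≤ ∫ _, r n ^ 2 ∂P := by
          refine integral_mono_ae (hD2int n) (integrable_const _) ?_
          filter_upwards [hr n] with ω hω
          have := abs_nonneg (D n ω)
          simp only [Pi.mul_apply]
          rw [← abs_mul_abs_self]; nlinarith
        simpa using this
      linarith
  have hsetmono : Monotone fun n => {ω | ∃ k ∈ Finset.range (n + 1), η ≤ |W k ω|} := by
    intro a b hab ω ⟨k, hk, h⟩
    exact ⟨k, by simp at hk ⊢; omega, h⟩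
  have hset : {ω | ∃ n, η ≤ |W n ω|} = ⋃ n, {ω | ∃ k ∈ Finset.range (n + 1), η ≤ |W k ω|} := by
    ext ω
    simp only [mem_ofPred_eq, mem_iUnion]
    exact ⟨fun ⟨n, h⟩ => ⟨n, n, by simp, h⟩, fun ⟨_, k, _, h⟩ => ⟨k, h⟩⟩
  change P {ω | ∃ n, η ≤ |W n ω|} ≤ _
  rw [hset, hsetmono.measure_iUnion]
  refine iSup_le fun n => ?_
  have hmax := maximal_ineq hsub (fun n ω => mul_self_nonneg (W n ω))
    (ε := (η ^ 2).toNNReal) n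
  have hη2 : (0 : ℝ) < η ^ 2 := by positivity
  have hseteq : {ω | ∃ k ∈ Finset.range (n + 1), η ≤ |W k ω|} =
      {ω | (((η ^ 2).toNNReal : NNReal) : ℝ) ≤ (Finset.range (n + 1)).sup'
        Finset.nonempty_range_add_one fun k => (W k * W k) ω} := by
    ext ω
    simp only [mem_ofPred_eq, Finset.le_sup'_iff, Real.coe_toNNReal _ hη2.le, Pi.mul_apply]
    refine exists_congr fun k => and_congr_right fun _ => ?_
    rw [← sq, ← sq_abs (W k ω)]
    exact (pow_le_pow_iff_left₀ hη.le (abs_nonneg _) two_ne_zero).symm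
  rw [hseteq, ENNReal.ofReal_div_of_pos hη2,
    ENNReal.le_div_iff_mul_le (Or.inl (by simpa using hη.ne')) (Or.inl ENNReal.ofReal_ne_top),
    mul_comm]
  refine hmax.trans (ENNReal.ofReal_le_ofReal ?_)
  calc _ ≤ ∫ ω, (W n * W n) ω ∂P :=
        setIntegral_le_integral (hW2int n) (ae_of_all _ fun ω => mul_self_nonneg (W n ω))
    _ ≤ _ := hsecond n
    _ ≤ _ := hs.sum_le_tsum _ fun _ _ => sq_nonneg _

end Martingale

/-- Summation by parts: bounded partial sums of `d` bound the partial sums of `w * d` when `w` is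
increasing. -/
theorem abs_sum_mul_le_of_abs_sum_le {w d : ℕ → ℝ} {η : ℝ} (hw0 : 0 ≤ w 0) (hw : Monotone w)
    (hd : ∀ n, |∑ k ∈ Finset.range n, d k| ≤ η) (n : ℕ) :
    |∑ k ∈ Finset.range (n + 1), w k * d k| ≤ 2 * η * w n := by
  -- Abel summation: the remainder is a sum of partial sums of `d` weighted by the nonnegative
  -- increments of `w`, which telescope.
  have key : ∀ n, |∑ k ∈ Finset.range (n + 1), w k * d k -
      w n * ∑ k ∈ Finset.range (n + 1), d k| ≤ η * (w n - w 0) := by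
    intro n
    induction n with
    | zero => simp
    | succ n ih =>
      have e : ∑ k ∈ Finset.range (n + 1 + 1), w k * d k -
          w (n + 1) * ∑ k ∈ Finset.range (n + 1 + 1), d k =
          (∑ k ∈ Finset.range (n + 1), w k * d k - w n * ∑ k ∈ Finset.range (n + 1), d k) -
          (w (n + 1) - w n) * ∑ k ∈ Finset.range (n + 1), d k := by
        rw [Finset.sum_range_succ _ (n + 1), Finset.sum_range_succ d (n + 1)]; ring
      have hwn : 0 ≤ w (n + 1) - w n := sub_nonneg.2 (hw n.le_succ)
      have hb : |(w (n + 1) - w n) * ∑ k ∈ Finset.range (n + 1), d k| ≤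
          (w (n + 1) - w n) * η := by
        rw [abs_mul, abs_of_nonneg hwn]
        exact mul_le_mul_of_nonneg_left (hd _) hwn
      rw [e]
      refine (abs_sub _ _).trans ?_
      linarith
  have hwn : 0 ≤ w n := hw0.trans (hw n.zero_le)
  have hη : 0 ≤ η := (abs_nonneg _).trans (hd 0)
  have h2 : |w n * ∑ k ∈ Finset.range (n + 1), d k| ≤ w n * η := by
    rw [abs_mul, abs_of_nonneg hwn]
    exact mul_le_mul_of_nonneg_left (hd _) hwn
  have h3 := abs_sub_abs_le_abs_sub (∑ k ∈ Finset.range (n + 1), w k * d k)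
    (w n * ∑ k ∈ Finset.range (n + 1), d k)
  nlinarith [key n, mul_nonneg hη hw0]

/-! ### Step sizes, weighted noise and accumulated offset -/

section StepSize

theorem stepSize_pos {γ : ℝ} (hγ : 0 < γ) (p : ℝ) {t : ℕ} (ht : 1 ≤ t) : 0 < stepSize γ p t :=
  div_pos hγ (Real.rpow_pos_of_pos (by exact_mod_cast ht) _)

theorem stepSize_le {γ p : ℝ} (hγ : 0 < γ) (hp : 0 ≤ p) {t : ℕ} (ht : 1 ≤ t) :
    stepSize γ p t ≤ γ :=
  div_le_self hγ.le (Real.one_le_rpow (by exact_mod_cast ht) hp)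

theorem stepSize_sum_nonneg {γ : ℝ} (hγ : 0 < γ) (p : ℝ) (t : ℕ) :
    0 ≤ ∑ s ∈ Finset.Icc 1 t, stepSize γ p s :=
  Finset.sum_nonneg fun _ hs => (stepSize_pos hγ p (Finset.mem_Icc.1 hs).1).le

/-- The step sizes are nonincreasing. This makes the normalized noise `O(t^(q-1))` whatever the
value of `p`. -/
theorem mul_stepSize_le_sum {γ p : ℝ} (hγ : 0 < γ) (hp : 0 ≤ p) (t : ℕ) :
    t * stepSize γ p t ≤ ∑ s ∈ Finset.Icc 1 t, stepSize γ p s := by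
  have h : ∀ s ∈ Finset.Icc 1 t, stepSize γ p t ≤ stepSize γ p s := by
    intro s hs
    obtain ⟨h1, h2⟩ := Finset.mem_Icc.1 hs
    have : (0 : ℝ) < s := by exact_mod_cast h1
    exact div_le_div_of_nonneg_left hγ.le (Real.rpow_pos_of_pos this _)
      (Real.rpow_le_rpow this.le (by exact_mod_cast h2) hp)
  simpa using Finset.card_nsmul_le_sum _ _ _ h

/-- The weighted noise bounds `γ_t K t^q / (M + ε ∑_{s ≤ t} γ_s)` are square-summable, with a sum
that vanishes as `M` grows. -/
theorem exists_tsum_sq_le {γ p q : ℝ} (hγ : 0 < γ) (hp : 0 ≤ p) (hq : q < 1 / 2) (K : ℝ)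
    {ε δ : ℝ} (hε : 0 < ε) (hδ : 0 < δ) :
    ∃ M : ℝ, 0 < M ∧
      Summable (fun n : ℕ => (stepSize γ p (n + 1) * (K * ((n + 1 : ℕ) : ℝ) ^ q) /
        (M + ε * ∑ s ∈ Finset.Icc 1 (n + 1), stepSize γ p s)) ^ 2) ∧
      ∑' n : ℕ, (stepSize γ p (n + 1) * (K * ((n + 1 : ℕ) : ℝ) ^ q) /
        (M + ε * ∑ s ∈ Finset.Icc 1 (n + 1), stepSize γ p s)) ^ 2 ≤ δ := by
  set f : ℝ → ℕ → ℝ := fun M n => (stepSize γ p (n + 1) * (K * ((n + 1 : ℕ) : ℝ) ^ q) /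
        (M + ε * ∑ s ∈ Finset.Icc 1 (n + 1), stepSize γ p s)) ^ 2 with hf
  -- A majorant free of `M`, for dominated convergence as `M → ∞`; its exponent is below `-1`
  -- exactly when `q < 1/2`.
  set g : ℕ → ℝ := fun n => (K / ε) ^ 2 * ((n + 1 : ℕ) : ℝ) ^ (2 * q - 2) with hg
  have hgs : Summable g := by
    refine Summable.mul_left _ ?_
    exact (summable_nat_add_iff (f := fun n : ℕ => (n : ℝ) ^ (2 * q - 2)) 1).2
      (Real.summable_nat_rpow.2 (by linarith))
  have hfg : ∀ M, 0 < M → ∀ n, ‖f M n‖ ≤ g n := by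
    intro M hM n
    have hn : (0 : ℝ) < ((n + 1 : ℕ) : ℝ) := by positivity
    have hs := stepSize_pos hγ p (Nat.le_add_left 1 n)
    have hsum := mul_stepSize_le_sum hγ hp (n + 1)
    set N : ℝ := ((n + 1 : ℕ) : ℝ)
    set σ := stepSize γ p (n + 1)
    have hden : ε * (N * σ) ≤ M + ε * ∑ s ∈ Finset.Icc 1 (n + 1), stepSize γ p s := by
      have := mul_le_mul_of_nonneg_left hsum hε.le
      linarith
    have hpos : 0 < ε * (N * σ) := by positivity
    simp only [hf, hg]
    rw [Real.norm_of_nonneg (sq_nonneg _)]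
    have e : (K / ε) ^ 2 * N ^ (2 * q - 2) = (σ * (K * N ^ q) / (ε * (N * σ))) ^ 2 := by
      rw [Real.rpow_sub hn, mul_comm 2 q, Real.rpow_mul hn.le]
      simp only [Real.rpow_ofNat]
      field_simp
    rw [e, div_pow, div_pow]
    exact div_le_div_of_nonneg_left (sq_nonneg _) (by positivity)
      (pow_le_pow_left₀ hpos.le hden 2)
  have hlim : Tendsto (fun M => ∑' n, f M n) atTop (𝓝 (∑' _ : ℕ, (0 : ℝ))) := by
    refine tendsto_tsum_of_dominated_convergence hgs (fun n => ?_) ?_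
    · have h1 : Tendsto (fun M : ℝ => M + ε * ∑ s ∈ Finset.Icc 1 (n + 1), stepSize γ p s)
          atTop atTop := tendsto_atTop_add_const_right _ _ tendsto_id
      have h2 := ((tendsto_const_nhds
        (x := stepSize γ p (n + 1) * (K * ((n + 1 : ℕ) : ℝ) ^ q))).div_atTop h1).pow 2
      simpa [hf] using h2
    · filter_upwards [eventually_gt_atTop 0] with M hM n using hfg M hM n
  rw [tsum_zero] at hlim
  obtain ⟨M, hM, hMδ⟩ := ((eventually_gt_atTop (0 : ℝ)).and
    (hlim.eventually (eventually_le_nhds hδ))).exists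
  exact ⟨M, hM, Summable.of_norm_bounded hgs (hfg M hM), hMδ⟩

/-- The accumulated offset is negligible with respect to the accumulated step sizes. -/
theorem exists_sum_offset_le {γ p b : ℝ} (hγ : 0 < γ) (hb : 0 < b) (K : ℝ) {ε : ℝ}
    (hε : 0 < ε) :
    ∃ R : ℝ, ∀ t : ℕ, ∑ s ∈ Finset.Icc 1 t, stepSize γ p s * (K / (s : ℝ) ^ b) ≤
      R + ε * ∑ s ∈ Finset.Icc 1 t, stepSize γ p s := by
  have hlim : Tendsto (fun s : ℕ => K / (s : ℝ) ^ b) atTop (𝓝 0) :=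
    tendsto_const_nhds.div_atTop ((tendsto_rpow_atTop hb).comp tendsto_natCast_atTop_atTop)
  obtain ⟨N, hN⟩ := eventually_atTop.1 (hlim.eventually (eventually_le_nhds hε))
  -- `R` pays for the finitely many stages up to `N`; from `N` on, the offset bound is at most `ε`.
  refine ⟨∑ s ∈ Finset.Icc 1 N, |stepSize γ p s * (K / (s : ℝ) ^ b)|, fun t => ?_⟩
  induction t with
  | zero =>
    simp only [Finset.Icc_eq_empty_of_lt zero_lt_one, Finset.sum_empty, mul_zero, add_zero]
    exact Finset.sum_nonneg fun _ _ => abs_nonneg _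
  | succ t ih =>
    rcases le_total N (t + 1) with h | h
    · rw [Finset.sum_Icc_succ_top (by omega), Finset.sum_Icc_succ_top (by omega)]
      have := mul_le_mul_of_nonneg_left (hN _ h) (stepSize_pos hγ p (Nat.le_add_left 1 t)).le
      push_cast at this ⊢
      linarith
    · calc _ ≤ ∑ s ∈ Finset.Icc 1 (t + 1), |stepSize γ p s * (K / (s : ℝ) ^ b)| :=
            Finset.sum_le_sum fun _ _ => le_abs_self _
        _ ≤ ∑ s ∈ Finset.Icc 1 N, |stepSize γ p s * (K / (s : ℝ) ^ b)| :=
            Finset.sum_le_sum_of_subset_of_nonneg (Finset.Icc_subset_Icc_right h)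
              fun _ _ _ => abs_nonneg _
        _ ≤ _ := le_add_of_nonneg_right
            (mul_nonneg hε.le (stepSize_sum_nonneg hγ p (t + 1)))

end StepSize

/-! ### Rate function and regularized choice -/

section Rate

theorem IsKernel.le_rate {θ : ℝ → ℝ} (hθ : IsKernel θ) {x z : ℝ} (hx : x ∈ Ioc (0 : ℝ) 1)
    (hz : kerDeriv θ x ≤ z) : x ≤ rate θ z := by
  classical
  have h1 : ¬ (z : EReal) ≤ slopeZero θ := by
    rw [not_le]
    have hx2 : x / 2 ∈ Ioc (0 : ℝ) 1 := ⟨by linarith [hx.1], by linarith [hx.1, hx.2]⟩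
    have hlt : kerDeriv θ (x / 2) < kerDeriv θ x :=
      hθ.strictMonoOn hx2 hx (by linarith [hx.1])
    exact (iInf_le (fun w : Ioc (0 : ℝ) 1 => (kerDeriv θ w : EReal)) ⟨x / 2, hx2⟩).trans_lt
      (EReal.coe_lt_coe_iff.2 (hlt.trans_le hz))
  unfold rate
  rw [if_neg h1]
  split_ifs with h2
  · exact hx.2
  · have him : z ∈ kerDeriv θ '' Ioc 0 1 := by
      obtain ⟨w, hw, hwz⟩ := intermediate_value_Icc hx.2
        (hθ.differentiableOn_deriv.continuousOn.mono fun w hw => ⟨hx.1.trans_le hw.1, hw.2⟩)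
        ⟨hz, (not_le.1 h2).le⟩
      exact ⟨w, ⟨hx.1.trans_le hw.1, hw.2⟩, hwz⟩
    have hmem := Function.invFunOn_mem him
    have heq := Function.invFunOn_eq him
    rw [← heq] at hz
    exact (hθ.strictMonoOn.le_iff_le hx hmem).1 hz

theorem IsKernel.rate_nonneg {θ : ℝ → ℝ} (hθ : IsKernel θ) (z : ℝ) : 0 ≤ rate θ z := by
  by_cases h : (z : EReal) ≤ slopeZero θ
  · unfold rate
    rw [if_pos h]
  · obtain ⟨⟨w, hw⟩, hwz⟩ := iInf_lt_iff.1 (not_le.1 h)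
    exact hw.1.le.trans (hθ.le_rate hw (EReal.coe_le_coe_iff.1 hwz.le))

/-- Mass on an action `a` of a regularized choice is limited by the score disadvantage of `a`
against any other action `b`. -/
theorem IsKernel.kerDeriv_le_of_mem_choice {θ : ℝ → ℝ} (hθ : IsKernel θ) {α : Type*} [Fintype α]
    [DecidableEq α] {y x : α → ℝ} (hx : x ∈ choice θ y) {a b : α} (hab : a ≠ b) (ha : 0 < x a) :
    kerDeriv θ (x a) ≤ kerDeriv θ 1 + (y a - y b) := by
  obtain ⟨hxs, hmax⟩ := hx
  have hx0 := hxs.1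
  have hsum2 : x a + x b ≤ 1 := by
    rw [← hxs.2, ← Finset.sum_pair hab]
    exact Finset.sum_le_sum_of_subset_of_nonneg (Finset.subset_univ _) fun i _ _ => hx0 i
  have hderiv : ∀ z ∈ Ioo (0 : ℝ) 1, HasDerivAt θ (kerDeriv θ z) z := fun z hz =>
    ((hθ.differentiableOn z ⟨hz.1, hz.2.le⟩).hasDerivWithinAt).hasDerivAt
      (Ioc_mem_nhds hz.1 hz.2)
  have hmvt : ∀ s t, 0 ≤ s → s < t → t ≤ 1 →
      ∃ z ∈ Ioo s t, θ t - θ s = kerDeriv θ z * (t - s) := by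
    intro s t hs hst ht
    obtain ⟨z, hz, he⟩ := exists_hasDerivAt_eq_slope θ (kerDeriv θ) hst
      (hθ.continuousOn.mono (Icc_subset_Icc hs ht))
      (fun z hz => hderiv z ⟨hs.trans_lt hz.1, hz.2.trans_le ht⟩)
    refine ⟨z, hz, ?_⟩
    rw [he, div_mul_cancel₀ _ (sub_pos.2 hst).ne']
  -- Moving mass `ε = x a - w` from `a` to `b` stays in the simplex and cannot improve the
  -- objective. Mean values at interior points avoid a derivative at `x b`, which may be `0`;
  -- letting `w` increase to `x a` gives the claim.
  have hlow : ∀ w ∈ Ioo 0 (x a), kerDeriv θ w ≤ kerDeriv θ 1 + (y a - y b) := by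
    intro w hw
    set ε := x a - w with hε
    have hεpos : 0 < ε := sub_pos.2 hw.2
    have hεa : ε < x a := by linarith [hw.1]
    obtain ⟨z, hz, hza⟩ := hmvt (x a - ε) (x a) (by linarith) (by linarith)
      (by linarith [hx0 b])
    obtain ⟨z', hz', hzb⟩ := hmvt (x b) (x b + ε) (hx0 b) (by linarith) (by linarith)
    have hz1 : kerDeriv θ w ≤ kerDeriv θ z := hθ.strictMonoOn.monotoneOn
      ⟨hw.1, by linarith [hw.2, hx0 b]⟩ ⟨by linarith [hz.1, hw.1], by linarith [hz.2, hx0 b]⟩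
      (by linarith [hz.1])
    have hz1' : kerDeriv θ z' ≤ kerDeriv θ 1 := hθ.strictMonoOn.monotoneOn
      ⟨(hx0 b).trans_lt hz'.1, by linarith [hz'.2]⟩ ⟨one_pos, le_rfl⟩ (by linarith [hz'.2])
    set x' : α → ℝ := x + (Pi.single b ε - Pi.single a ε) with hx'
    have ea : x' a = x a - ε := by simp [hx', hab]; ring
    have eb : x' b = x b + ε := by simp [hx', hab.symm]
    have eo : ∀ c, c ≠ a → c ≠ b → x' c = x c := by
      intro c h1 h2; simp [hx', h1, h2]
    have hx's : x' ∈ stdSimplex ℝ α := by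
      refine ⟨fun c => ?_, ?_⟩
      · rcases eq_or_ne c a with rfl | h1
        · rw [ea]; linarith
        rcases eq_or_ne c b with rfl | h2
        · rw [eb]; linarith [hx0 c]
        rw [eo c h1 h2]; exact hx0 c
      · simp [hx', Finset.sum_add_distrib, hxs.2]
    have hle : ∑ c, y c * x' c - ∑ c, θ (x' c) ≤ ∑ c, y c * x c - ∑ c, θ (x c) := hmax hx's
    have hdiff : ∀ f : α → ℝ → ℝ, ∑ c, f c (x' c) - ∑ c, f c (x c) =
        (f a (x a - ε) - f a (x a)) + (f b (x b + ε) - f b (x b)) := by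
      intro f
      rw [← Finset.sum_sub_distrib, ← ea, ← eb,
        ← Finset.sum_pair (f := fun c => f c (x' c) - f c (x c)) hab]
      refine (Finset.sum_subset (Finset.subset_univ _) fun c _ hc => ?_).symm
      simp only [Finset.mem_insert, Finset.mem_singleton, not_or] at hc
      rw [eo c hc.1 hc.2, sub_self]
    have d1 := hdiff fun c t => y c * t
    have d2 := hdiff fun _ t => θ t
    have hfin : ε * kerDeriv θ z ≤ ε * (kerDeriv θ z' + (y a - y b)) := by
      have : x a - (x a - ε) = ε := by ring
      rw [this] at hza
      rw [add_sub_cancel_left] at hzb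
      linarith
    have := le_of_mul_le_mul_left hfin hεpos
    linarith
  have hxa1 : x a ∈ Ioc (0 : ℝ) 1 := ⟨ha, by linarith [hx0 b]⟩
  have hcont : Tendsto (kerDeriv θ) (𝓝[<] x a) (𝓝 (kerDeriv θ (x a))) := by
    refine (hθ.differentiableOn_deriv.continuousOn _ hxa1).mono_left ?_
    rw [← nhdsWithin_Ioo_eq_nhdsLT ha]
    exact nhdsWithin_mono _ fun w hw => ⟨hw.1, hw.2.le.trans hxa1.2⟩
  refine le_of_tendsto hcont ?_
  filter_upwards [Ioo_mem_nhdsLT ha] with w hw using hlow w hw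

theorem IsKernel.apply_le_rate_of_mem_choice {θ : ℝ → ℝ} (hθ : IsKernel θ) {α : Type*} [Fintype α]
    {y x : α → ℝ} (hx : x ∈ choice θ y) {a b : α} (hab : a ≠ b) {z : ℝ}
    (hz : kerDeriv θ 1 + (y a - y b) ≤ z) : x a ≤ rate θ z := by
  classical
  rcases (hx.1.1 a).eq_or_lt' with h | h
  · rw [h]; exact hθ.rate_nonneg z
  · exact hθ.le_rate ⟨h, hx.1.2 ▸ Finset.single_le_sum (fun i _ => hx.1.1 i) (Finset.mem_univ a)⟩
      ((hθ.kerDeriv_le_of_mem_choice hx hab h).trans hz)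

theorem IsKernel.apply_le_of_mem_choice {θ : ℝ → ℝ} (hθ : IsKernel θ) {α : Type*} [Fintype α]
    {y x : α → ℝ} (hx : x ∈ choice θ y) {a b : α} (hab : a ≠ b) {η : ℝ} (hη : η ∈ Ioc (0 : ℝ) 1)
    (hz : kerDeriv θ 1 + (y a - y b) ≤ kerDeriv θ η) : x a ≤ η := by
  classical
  rcases (hx.1.1 a).eq_or_lt' with h | h
  · rw [h]; exact hη.1.le
  · exact (hθ.strictMonoOn.le_iff_le ⟨h, hx.1.2 ▸
      Finset.single_le_sum (fun i _ => hx.1.1 i) (Finset.mem_univ a)⟩ hη).1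
      ((hθ.kerDeriv_le_of_mem_choice hx hab h).trans hz)

end Rate

/-! ### Distance to a face -/

section Face

variable {ι : Type*} [Fintype ι] {A : ι → Type*} [∀ i, Fintype (A i)]

/-- All mass off `B i` is moved onto one action of `B i`, which gains at most `card (A i) * r`. -/
theorem infDist_face_le {B : ∀ i, Set (A i)} (hB : ∀ i, (B i).Nonempty) {x : ∀ j, A j → ℝ}
    (hx : ∀ i, x i ∈ stdSimplex ℝ (A i)) {r : ℝ} (hr : 0 ≤ r) (hxr : ∀ i, ∀ a ∉ B i, x i a ≤ r) :
    Metric.infDist x (face B) ≤ (1 + ∑ i, (Fintype.card (A i) : ℝ)) * r := by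
  classical
  choose b hb using hB
  set w : ∀ i, A i → ℝ := fun i a => if a ∈ B i then 0 else x i a with hw
  set x' : ∀ i, A i → ℝ := fun i => x i - w i + Pi.single (b i) (∑ a, w i a) with hx'
  have hw0 : ∀ i a, 0 ≤ w i a := fun i a => by
    simp only [hw]; split_ifs
    · exact le_rfl
    · exact (hx i).1 a
  have hwr : ∀ i a, w i a ≤ r := fun i a => by
    simp only [hw]; split_ifs with h
    · exact hr
    · exact hxr i a h
  have hmem : x' ∈ face B := by
    refine fun i => ⟨⟨fun a => ?_, ?_⟩, fun a ha => ?_⟩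
    · have h1 : 0 ≤ x i a - w i a := by
        simp only [hw]; split_ifs
        · simpa using (hx i).1 a
        · simp
      have h2 : 0 ≤ (Pi.single (b i) (∑ a, w i a) : A i → ℝ) a := by
        rw [Pi.single_apply]; split_ifs
        · exact Finset.sum_nonneg fun a _ => hw0 i a
        · exact le_rfl
      exact add_nonneg h1 h2
    · simp [hx', Finset.sum_add_distrib, (hx i).2]
    · have : a ≠ b i := by rintro rfl; exact ha (hb i)
      simp [hx', hw, ha, this]
  have hcard : ∀ i, (Fintype.card (A i) : ℝ) ≤ ∑ i, (Fintype.card (A i) : ℝ) := fun i =>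
    Finset.single_le_sum (f := fun i => (Fintype.card (A i) : ℝ))
      (fun i _ => Nat.cast_nonneg _) (Finset.mem_univ i)
  have hN : 0 ≤ ∑ i, (Fintype.card (A i) : ℝ) := Finset.sum_nonneg fun i _ => Nat.cast_nonneg _
  refine (Metric.infDist_le_dist_of_mem hmem).trans ?_
  refine (dist_pi_le_iff (by positivity)).2 fun i => (dist_pi_le_iff (by positivity)).2 fun a => ?_
  have hsum : ∑ a, w i a ≤ (∑ i, (Fintype.card (A i) : ℝ)) * r := by
    calc ∑ a, w i a ≤ Fintype.card (A i) * r := by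
          simpa using Finset.sum_le_card_nsmul Finset.univ (w i) r fun a _ => hwr i a
      _ ≤ _ := mul_le_mul_of_nonneg_right (hcard i) hr
  have hsum0 : 0 ≤ ∑ a, w i a := Finset.sum_nonneg fun a _ => hw0 i a
  have e : x i a - x' i a = w i a - (Pi.single (b i) (∑ a, w i a) : A i → ℝ) a := by
    simp only [hx', Pi.add_apply, Pi.sub_apply]; ring
  rw [Real.dist_eq, e, abs_le, Pi.single_apply]
  have := hw0 i a
  have := hwr i a
  constructor <;> split_ifs <;> nlinarith

end Face

/-! ### Payoff gap near a club face -/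

section ClubGame

variable {ι : Type*} [Fintype ι] [DecidableEq ι]
  {A : ι → Type*} [∀ i, Fintype (A i)]

theorem continuous_mixedPayoff (u : ι → (∀ j, A j) → ℝ) (i : ι) :
    Continuous (mixedPayoff u i) := by
  unfold mixedPayoff
  fun_prop

variable [∀ i, DecidableEq (A i)]

theorem continuous_payoffVec (u : ι → (∀ j, A j) → ℝ) (i : ι) (a : A i) :
    Continuous fun x => payoffVec u x i a :=
  (continuous_mixedPayoff u i).comp (continuous_id.update i continuous_const)

/-- Otherwise, with player `i` playing `b` and the others unchanged, a deviation to `a` would be a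
weakly better reply that leaves the face. -/
theorem IsClub.payoffVec_lt {u : ι → (∀ j, A j) → ℝ} {B : ∀ i, Set (A i)}
    (h : IsClub u (face B)) {x : ∀ j, A j → ℝ} (hx : x ∈ face B) {i : ι} {a b : A i}
    (ha : a ∉ B i) (hb : b ∈ B i) : payoffVec u x i a < payoffVec u x i b := by
  by_contra! hle
  have hx' : Function.update x i (Pi.single b 1) ∈ face B := by
    intro j
    rcases eq_or_ne j i with rfl | hj
    · rw [Function.update_self]
      refine ⟨single_mem_stdSimplex ℝ b, fun c hc => ?_⟩
      rw [Pi.single_eq_of_ne (by rintro rfl; exact hc hb)]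
    · rw [Function.update_of_ne hj]; exact hx j
  have := h _ hx' (Function.update x i (Pi.single a 1)) (fun j => by
    rcases eq_or_ne j i with rfl | hj
    · rw [Function.update_self]
      refine ⟨single_mem_stdSimplex ℝ a, ?_⟩
      rw [Function.update_idem]
      exact hle
    · have hz : Function.update x i (Pi.single b 1) j = x j := Function.update_of_ne hj _ _
      rw [Function.update_of_ne hj]
      refine ⟨(hx j).1, ?_⟩
      rw [← hz, Function.update_eq_self])
  have h0 := (this i).2 a ha
  simp at h0

/-- Near a club face, actions off the face are worse than actions on it by a uniform margin. -/
theorem IsClub.exists_payoffVec_gap {u : ι → (∀ j, A j) → ℝ} {B : ∀ i, Set (A i)}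
    (h : IsClub u (face B)) :
    ∃ c η : ℝ, 0 < c ∧ η ∈ Ioc (0 : ℝ) 1 ∧ ∀ x : ∀ j, A j → ℝ,
      (∀ i, x i ∈ stdSimplex ℝ (A i)) → (∀ i, ∀ a ∉ B i, x i a ≤ η) →
      ∀ i, ∀ a ∉ B i, ∀ b ∈ B i, c ≤ payoffVec u x i b - payoffVec u x i a := by
  -- Counterexamples with margin and radius `1 / (n + 1)` accumulate at a point of the face that
  -- violates the strict inequality there.
  by_contra! hcon
  have hcon' := fun n : ℕ => hcon (1 / ((n : ℝ) + 1)) (1 / ((n : ℝ) + 1)) (by positivity)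
    ⟨by positivity, by rw [div_le_one (by positivity)]; simp⟩
  choose x hxs hxη i a ha b hb hgap using hcon'
  have hK : IsCompact (univ.pi fun i => stdSimplex ℝ (A i)) :=
    isCompact_univ_pi fun i => isCompact_stdSimplex ℝ (A i)
  -- A constant subsequence of the finitely many index triples.
  obtain ⟨⟨i₀, a₀, b₀⟩, hfreq⟩ : ∃ k : Σ i, A i × A i,
      ∃ᶠ n in atTop, (⟨i n, a n, b n⟩ : Σ i, A i × A i) = k := by
    by_contra! hno
    obtain ⟨n, hn⟩ := (eventually_all.2 hno).exists
    exact hn _ rfl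
  obtain ⟨φ, hφ, hφeq⟩ := extraction_of_frequently_atTop hfreq
  obtain ⟨x₀, hx₀, ψ, hψ, hlim⟩ := hK.tendsto_subseq (x := fun n => x (φ n))
    (fun n i _ => hxs (φ n) i)
  have hzero : Tendsto (fun n => 1 / ((φ (ψ n) : ℝ) + 1)) atTop (𝓝 0) :=
    tendsto_one_div_add_atTop_nhds_zero_nat.comp ((hφ.comp hψ).tendsto_atTop)
  have hface : x₀ ∈ face B := fun j => ⟨hx₀ j trivial, fun c hc => by
    refine le_antisymm ?_ ((hx₀ j trivial).1 c)
    have hlim' : Tendsto (fun n => x (φ (ψ n)) j c) atTop (𝓝 (x₀ j c)) :=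
      tendsto_pi_nhds.1 (tendsto_pi_nhds.1 hlim j) c
    exact le_of_tendsto_of_tendsto' hlim' hzero fun n => hxη _ j c hc⟩
  have hmem : a₀ ∉ B i₀ ∧ b₀ ∈ B i₀ := by
    have h1 := ha (φ 0)
    have h2 := hb (φ 0)
    have h3 := hφeq 0
    obtain ⟨rfl, h4⟩ := Sigma.mk.inj h3
    obtain ⟨rfl, rfl⟩ := Prod.mk.inj (eq_of_heq h4)
    exact ⟨h1, h2⟩
  have hle : payoffVec u x₀ i₀ b₀ - payoffVec u x₀ i₀ a₀ ≤ 0 := by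
    refine le_of_tendsto_of_tendsto'
      ((((continuous_payoffVec u i₀ b₀).sub (continuous_payoffVec u i₀ a₀)).tendsto x₀).comp hlim)
      hzero fun n => ?_
    change payoffVec u (x (φ (ψ n))) i₀ b₀ - payoffVec u (x (φ (ψ n))) i₀ a₀ ≤ _
    have h1 := hgap (φ (ψ n))
    have h3 := hφeq (ψ n)
    generalize φ (ψ n) = k at *
    obtain ⟨rfl, h4⟩ := Sigma.mk.inj h3
    obtain ⟨rfl, rfl⟩ := Prod.mk.inj (eq_of_heq h4)
    exact h1.le
  linarith [h.payoffVec_lt hface hmem.1 hmem.2]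

end ClubGame

/-! ### Uniform control of the noise -/

section Noise

variable {ι : Type*} [Fintype ι] [DecidableEq ι]
  {A : ι → Type*} [∀ i, Fintype (A i)] [∀ i, DecidableEq (A i)]
  {Ω : Type*} {m : MeasurableSpace Ω} {P : Measure Ω}
  {u : ι → (∀ j, A j) → ℝ} {θ : ℝ → ℝ} {γ p Kb b Ku q : ℝ} {ℱ : Filtration ℕ m}
  {X Y V : ℕ → Ω → ∀ j, A j → ℝ}

/-- The signal is recovered from two consecutive scores, so adaptedness of the scores suffices. -/
theorem IsLearning.stronglyMeasurable_signal (h : IsLearning u θ γ p Kb b Ku q P ℱ X Y V)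
    (hγ : 0 < γ) {t : ℕ} (ht : 1 ≤ t) : StronglyMeasurable[ℱ (t + 1)] (V t) := by
  have hs := (stepSize_pos hγ p ht).ne'
  have e : V t = fun ω => (stepSize γ p t)⁻¹ • (Y (t + 1) ω - Y t ω) := by
    ext1 ω
    rw [h.aggregate t ht ω, add_sub_cancel_left, inv_smul_smul₀ hs]
  have hY : StronglyMeasurable[ℱ (t + 1)] fun ω => Y (t + 1) ω - Y t ω :=
    (h.adapted (t + 1) (by omega)).sub ((h.adapted t ht).mono (ℱ.mono t.le_succ))
  rw [e]
  exact hY.const_smul (stepSize γ p t)⁻¹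

/-- The accumulated noise on a score is, with high probability and at all times, small compared
with the accumulated step sizes, up to the constant `M`. -/
theorem IsLearning.measure_noise_le [IsProbabilityMeasure P]
    (h : IsLearning u θ γ p Kb b Ku q P ℱ X Y V)
    (hγ : 0 < γ) {M ε δ : ℝ} (hM : 0 < M) (hε : 0 < ε)
    (hs : Summable (fun n : ℕ => (stepSize γ p (n + 1) * (Ku * ((n + 1 : ℕ) : ℝ) ^ q) /
        (M + ε * ∑ s ∈ Finset.Icc 1 (n + 1), stepSize γ p s)) ^ 2))
    (hδ : ∑' n : ℕ, (stepSize γ p (n + 1) * (Ku * ((n + 1 : ℕ) : ℝ) ^ q) /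
        (M + ε * ∑ s ∈ Finset.Icc 1 (n + 1), stepSize γ p s)) ^ 2 ≤ δ) (i : ι) (a : A i) :
    P {ω | ∃ t : ℕ, M + ε * ∑ s ∈ Finset.Icc 1 t, stepSize γ p s <
      |∑ s ∈ Finset.Icc 1 t, stepSize γ p s * (V s ω - (P[V s | ℱ s]) ω) i a|} ≤
      ENNReal.ofReal (4 * δ) := by
  set w : ℕ → ℝ := fun n => M + ε * ∑ s ∈ Finset.Icc 1 (n + 1), stepSize γ p s with hw
  have hwpos : ∀ n, 0 < w n := fun n =>
    add_pos_of_pos_of_nonneg hM (mul_nonneg hε.le (stepSize_sum_nonneg hγ p _))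
  have hwmono : Monotone w := monotone_nat_of_le_succ fun n => by
    simp only [hw]
    rw [Finset.sum_Icc_succ_top (by omega : 1 ≤ n + 1 + 1)]
    have := mul_pos hε (stepSize_pos hγ p (by omega : 1 ≤ n + 1 + 1))
    linarith
  let T : (∀ j, A j → ℝ) →L[ℝ] ℝ :=
    (ContinuousLinearMap.proj a).comp (ContinuousLinearMap.proj (R := ℝ) (φ := fun j => A j → ℝ) i)
  have hT : ∀ x, T x = x i a := fun _ => rfl
  let 𝒢 : Filtration ℕ m := ⟨fun n => ℱ (n + 1), fun _ _ hab => ℱ.mono (Nat.succ_le_succ hab),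
    fun n => ℱ.le (n + 1)⟩
  have h𝒢 : ∀ n, 𝒢 n = ℱ (n + 1) := fun _ => rfl
  let U : ℕ → Ω → ∀ j, A j → ℝ := fun n => V (n + 1) - P[V (n + 1) | ℱ (n + 1)]
  have hUint : ∀ n, Integrable (U n) P := fun n =>
    (h.integrable (n + 1) (by omega)).sub integrable_condExp
  let D : ℕ → Ω → ℝ := fun n => (stepSize γ p (n + 1) / w n) • (T ∘ U n)
  have hD : ∀ n ω, D n ω = stepSize γ p (n + 1) / w n *
      (V (n + 1) ω - (P[V (n + 1) | ℱ (n + 1)]) ω) i a := fun n ω => rfl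
  have hUmeas : ∀ n, StronglyMeasurable[ℱ (n + 1 + 1)] (U n) := fun n =>
    (h.stronglyMeasurable_signal hγ (by omega)).sub
      (stronglyMeasurable_condExp.mono (ℱ.mono (Nat.le_succ _)))
  have hadp : ∀ n, StronglyMeasurable[𝒢 (n + 1)] (D n) := fun n =>
    (T.continuous.comp_stronglyMeasurable (hUmeas n)).const_smul _
  have hbd : ∀ n, ∀ᵐ ω ∂P, |D n ω| ≤
      stepSize γ p (n + 1) * (Ku * ((n + 1 : ℕ) : ℝ) ^ q) / w n := by
    intro n
    have hc : 0 ≤ stepSize γ p (n + 1) / w n :=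
      (div_pos (stepSize_pos hγ p (by omega)) (hwpos n)).le
    filter_upwards [h.noise (n + 1) (by omega)] with ω hω
    rw [hD, abs_mul, abs_of_nonneg hc, mul_div_right_comm]
    refine mul_le_mul_of_nonneg_left (le_trans ?_ hω) hc
    set z := V (n + 1) ω - (P[V (n + 1) | ℱ (n + 1)]) ω
    exact (norm_le_pi_norm (z i) a).trans (norm_le_pi_norm z i)
  have hzero : ∀ n, P[D n | 𝒢 n] =ᵐ[P] 0 := by
    intro n
    have e1 := condExp_smul (μ := P) (stepSize γ p (n + 1) / w n) (T ∘ U n) (𝒢 n)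
    have e2 := T.comp_condExp_comm (m := 𝒢 n) (hUint n)
    have e3 := condExp_sub (h.integrable (n + 1) (by omega))
      (integrable_condExp (μ := P) (m := ℱ (n + 1)) (f := V (n + 1))) (𝒢 n)
    have e4 : P[P[V (n + 1) | ℱ (n + 1)] | 𝒢 n] = P[V (n + 1) | ℱ (n + 1)] :=
      condExp_of_stronglyMeasurable (ℱ.le _) stronglyMeasurable_condExp integrable_condExp
    filter_upwards [e1, e2, e3] with ω a1 a2 a3
    rw [e4, Pi.sub_apply, h𝒢, sub_self] at a3
    rw [a1, Pi.smul_apply, ← a2, Function.comp_apply, h𝒢, a3]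
    simp
  -- Level `1/2` offsets the factor `2` of summation by parts; its square yields the `4` in the
  -- bound.
  have key := measure_exists_le_abs_sum_le hadp hbd hzero hs (half_pos one_pos)
  refine (measure_mono ?_).trans (key.trans (ENNReal.ofReal_le_ofReal ?_))
  · rintro ω ⟨t, ht⟩
    by_contra hno
    simp only [mem_ofPred_eq, not_exists, not_le] at hno
    rcases t with _ | t
    · simp at ht; linarith
    have hab := abs_sum_mul_le_of_abs_sum_le (hwpos 0).le hwmono (fun n => (hno n).le) t
    have e : ∑ k ∈ Finset.range (t + 1), w k * D k ω =
        ∑ s ∈ Finset.Icc 1 (t + 1), stepSize γ p s * (V s ω - (P[V s | ℱ s]) ω) i a := by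
      rw [Finset.range_eq_Ico, ← Finset.Ico_add_one_right_eq_Icc,
        Finset.sum_Ico_eq_sum_range, Finset.sum_Ico_eq_sum_range]
      refine Finset.sum_congr rfl fun k _ => ?_
      rw [hD, zero_add, add_comm 1 k, ← mul_assoc, mul_div_cancel₀ _ (hwpos k).ne']
    rw [e] at hab
    linarith
  · rw [div_le_iff₀ (by norm_num)]
    refine hδ.trans (le_of_eq ?_)
    ring

end Noise

/-! ### The set of initial scores -/

section ScoreGap

variable {ι : Type*} [Fintype ι] {A : ι → Type*} [∀ i, Fintype (A i)]

theorem isOpen_score_gap_lt (B : ∀ i, Set (A i)) (K : ℝ) :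
    IsOpen {y : ∀ j, A j → ℝ | ∀ i, ∀ a ∉ B i, ∀ b ∈ B i, y i a - y i b < K} := by
  simp only [ofPred_forall]
  refine isOpen_iInter_of_finite fun i => isOpen_iInter_of_finite fun a =>
    isOpen_iInter_of_finite fun _ => isOpen_iInter_of_finite fun b =>
    isOpen_iInter_of_finite fun _ => isOpen_lt ?_ continuous_const
  fun_prop

theorem not_isBounded_score_gap_lt [Nonempty ι] {B : ∀ i, Set (A i)}
    (hB : ∀ i, (B i).Nonempty) (K : ℝ) :
    ¬ Bornology.IsBounded {y : ∀ j, A j → ℝ | ∀ i, ∀ a ∉ B i, ∀ b ∈ B i, y i a - y i b < K} := by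
  classical
  intro hbd
  obtain ⟨r, hr⟩ := hbd.exists_norm_le
  obtain ⟨i₀⟩ := ‹Nonempty ι›
  obtain ⟨b₀, hb₀⟩ := hB i₀
  set L := |K| + |r| + 1 with hL
  let y : ∀ j, A j → ℝ := fun j a => if a ∈ B j then L else 0
  have hy : ‖y‖ ≤ r := hr y fun i a ha b hb => by
    simp only [y, if_neg ha, if_pos hb]
    linarith [neg_abs_le K, abs_nonneg r]
  have h1 : ‖y i₀ b₀‖ ≤ r := ((norm_le_pi_norm (y i₀) b₀).trans (norm_le_pi_norm y i₀)).trans hy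
  simp only [y, if_pos hb₀] at h1
  linarith [le_abs_self L, le_abs_self r, abs_nonneg K, Real.norm_eq_abs L]

end ScoreGap

/-! ### Bootstrap along a path and conclusion -/

section Main

variable {ι : Type*} [Fintype ι] [DecidableEq ι]
  {A : ι → Type*} [∀ i, Fintype (A i)] [∀ i, DecidableEq (A i)]

/-- If the noise and the offset are controlled along a path of play that starts with low enough
scores off the club face, then these scores decrease linearly in the accumulated step sizes. -/
theorem score_gap_le {u : ι → (∀ j, A j) → ℝ} {B : ∀ i, Set (A i)} (hB : ∀ i, (B i).Nonempty)
    {θ : ℝ → ℝ} (hθ : IsKernel θ) {γ p Kb b c η R M : ℝ} (hγ : 0 < γ) (hc : 0 < c)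
    (hη : η ∈ Ioc (0 : ℝ) 1)
    (hgap : ∀ x : ∀ j, A j → ℝ,
      (∀ i, x i ∈ stdSimplex ℝ (A i)) → (∀ i, ∀ a ∉ B i, x i a ≤ η) →
      ∀ i, ∀ a ∉ B i, ∀ b ∈ B i, c ≤ payoffVec u x i b - payoffVec u x i a)
    {x y v e : ℕ → ∀ j, A j → ℝ}
    (hagg : ∀ t, 1 ≤ t → y (t + 1) = y t + stepSize γ p t • v t)
    (hresp : ∀ t, 1 ≤ t → ∀ i, x t i ∈ choice θ (y t i))
    (hoff : ∀ t : ℕ, 1 ≤ t → ‖e t - payoffVec u (x t)‖ ≤ Kb / (t : ℝ) ^ b)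
    (hR : ∀ t : ℕ, ∑ s ∈ Finset.Icc 1 t, stepSize γ p s * (Kb / (s : ℝ) ^ b) ≤
      R + c / 8 * ∑ s ∈ Finset.Icc 1 t, stepSize γ p s)
    (hnoise : ∀ i a (t : ℕ), |∑ s ∈ Finset.Icc 1 t, stepSize γ p s * (v s - e s) i a| ≤
      M + c / 8 * ∑ s ∈ Finset.Icc 1 t, stepSize γ p s)
    (hinit : ∀ i, ∀ a ∉ B i, ∀ b ∈ B i, y 1 i a - y 1 i b ≤
      -(c / 2 * γ + (kerDeriv θ 1 - kerDeriv θ η) + 2 * R + 2 * M)) (t : ℕ) :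
    ∀ i, ∀ a ∉ B i, ∀ b ∈ B i, y (t + 1) i a - y (t + 1) i b ≤
      -(c / 2 * γ + (kerDeriv θ 1 - kerDeriv θ η)) -
        c / 2 * ∑ s ∈ Finset.Icc 1 t, stepSize γ p s := by
  induction t using Nat.strong_induction_on with
  | _ t ih =>
  -- The bound at earlier stages keeps play within `η` of the face, where the payoff gap applies.
  have hsmall : ∀ s ∈ Finset.Icc 1 t, ∀ i, ∀ a ∉ B i, x s i a ≤ η := by
    intro s hs i a ha
    obtain ⟨hs1, hst⟩ := Finset.mem_Icc.1 hs
    obtain ⟨s, rfl⟩ : ∃ r, s = r + 1 := ⟨s - 1, by omega⟩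
    obtain ⟨b, hb⟩ := hB i
    have := ih s (by omega) i a ha b hb
    have := mul_nonneg (half_pos hc).le (stepSize_sum_nonneg hγ p s)
    have := mul_pos (half_pos hc) hγ
    exact hθ.apply_le_of_mem_choice (hresp _ hs1 i) (b := b) (by rintro rfl; exact ha hb) hη (by linarith)
  have hy : ∀ t i a, y (t + 1) i a =
      y 1 i a + ∑ s ∈ Finset.Icc 1 t, stepSize γ p s * v s i a := by
    intro t i a
    induction t with
    | zero => simp
    | succ t iht =>
      rw [hagg (t + 1) (by omega), Finset.sum_Icc_succ_top (by omega), ← add_assoc, ← iht]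
      rfl
  intro i a ha b' hb
  have hdrift : ∑ s ∈ Finset.Icc 1 t, stepSize γ p s * (e s i a - e s i b') ≤
      ∑ s ∈ Finset.Icc 1 t,
        (-c * stepSize γ p s + 2 * (stepSize γ p s * (Kb / (s : ℝ) ^ b))) := by
    refine Finset.sum_le_sum fun s hs => ?_
    have hs1 := (Finset.mem_Icc.1 hs).1
    have hcoord : ∀ a, |e s i a - payoffVec u (x s) i a| ≤ Kb / (s : ℝ) ^ b := fun a =>
      ((norm_le_pi_norm ((e s - payoffVec u (x s)) i) a).trans
        (norm_le_pi_norm (e s - payoffVec u (x s)) i)).trans (hoff s hs1)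
    have h1 := (abs_le.1 (hcoord a)).2
    have h2 := (abs_le.1 (hcoord b')).1
    have h3 := hgap (x s) (fun i => (hresp s hs1 i).1) (hsmall s hs) i a ha b' hb
    have h4 : e s i a - e s i b' ≤ -c + 2 * (Kb / (s : ℝ) ^ b) := by linarith
    have := mul_le_mul_of_nonneg_left h4 (stepSize_pos hγ p hs1).le
    linarith
  rw [Finset.sum_add_distrib, ← Finset.mul_sum, ← Finset.mul_sum] at hdrift
  have hsplit : ∑ s ∈ Finset.Icc 1 t, stepSize γ p s * v s i a -
      ∑ s ∈ Finset.Icc 1 t, stepSize γ p s * v s i b' =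
      ∑ s ∈ Finset.Icc 1 t, stepSize γ p s * (e s i a - e s i b') +
      ∑ s ∈ Finset.Icc 1 t, stepSize γ p s * (v s - e s) i a -
      ∑ s ∈ Finset.Icc 1 t, stepSize γ p s * (v s - e s) i b' := by
    rw [← Finset.sum_sub_distrib, ← Finset.sum_add_distrib, ← Finset.sum_sub_distrib]
    refine Finset.sum_congr rfl fun s _ => ?_
    simp only [Pi.sub_apply]
    ring
  rw [hy t i a, hy t i b']
  -- Two coordinates each cost `c/8` for offset and `c/8` for noise, so slope `-c` becomes `-c/2`;
  -- `2 * R + 2 * M` in the initial gap absorbs the constants.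
  linarith [hinit i a ha b' hb, hR t, (abs_le.1 (hnoise i a t)).2, (abs_le.1 (hnoise i b' t)).1]

end Main

end RegLearn

open RegLearn

theorem theorem3 {ι : Type*} [Fintype ι] [DecidableEq ι] [Nonempty ι]
    {A : ι → Type*} [∀ i, Fintype (A i)] [∀ i, DecidableEq (A i)]
    (u : ι → (∀ j, A j) → ℝ)
    (B : ∀ i, Set (A i)) (hB : ∀ i, (B i).Nonempty) (hclub : RegLearn.IsClub u (RegLearn.face B))
    (θ : ℝ → ℝ) (hθ : RegLearn.IsKernel θ)
    (γ p Kb b Ku q : ℝ) (hγ : 0 < γ) (hp : p ∈ Set.Icc (0 : ℝ) 1)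
    (hb : 0 < b) (hq : 0 ≤ q) (hq' : q < 1 / 2) :
    ∃ C c₁ c₂ : ℝ, 0 < C ∧ 0 < c₂ ∧
      ∀ δ : ℝ, 0 < δ →
        ∃ D : Set (∀ j, A j → ℝ), IsOpen D ∧ ¬ Bornology.IsBounded D ∧
          ∀ (Ω : Type*) (m : MeasurableSpace Ω) (P : MeasureTheory.Measure Ω)
            (_ : MeasureTheory.IsProbabilityMeasure P) (ℱ : MeasureTheory.Filtration ℕ m)
            (X Y V : ℕ → Ω → ∀ j, A j → ℝ),
            RegLearn.IsLearning u θ γ p Kb b Ku q P ℱ X Y V →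
            (∀ᵐ ω ∂P, Y 1 ω ∈ D) →
            ENNReal.ofReal (1 - δ) ≤
              P {ω | ∀ t : ℕ, 1 ≤ t →
                Metric.infDist (X t ω) (RegLearn.face B) ≤
                  C * RegLearn.rate θ (c₁ - c₂ * ∑ s ∈ Finset.Icc 1 t, RegLearn.stepSize γ p s)} := by
  obtain ⟨c, η, hc, hη, hgap⟩ := hclub.exists_payoffVec_gap
  obtain ⟨R, hR⟩ := exists_sum_offset_le (p := p) hγ hb Kb (ε := c / 8) (by positivity)
  refine ⟨1 + ∑ i, (Fintype.card (A i) : ℝ), kerDeriv θ 1, c / 2, by positivity, by positivity,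
    fun δ hδ => ?_⟩
  set N : ℝ := (Fintype.card (Σ i, A i) : ℝ) with hN
  -- A union bound over `N` coordinates, each costing four times this value; `N + 1` keeps the ratio
  -- below one and the denominator positive.
  obtain ⟨M, hM, hsum, htsum⟩ := exists_tsum_sq_le hγ hp.1 hq' Ku (ε := c / 8)
    (δ := δ / (4 * (N + 1))) (by positivity) (by positivity)
  -- The term `c / 2 * γ` covers a lag: the scores at stage `t` contain steps up to `t - 1`, while
  -- the rate counts step `t`. The `θ'` difference forces masses below `η`.
  set K : ℝ := c / 2 * γ + (kerDeriv θ 1 - kerDeriv θ η) + 2 * R + 2 * M with hK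
  refine ⟨{y | ∀ i, ∀ a ∉ B i, ∀ b ∈ B i, y i a - y i b < -K}, isOpen_score_gap_lt B _,
    not_isBounded_score_gap_lt hB _, ?_⟩
  intro Ω m P _ ℱ X Y V h hinit
  set T : Set Ω := {ω | ∀ t : ℕ, 1 ≤ t → Metric.infDist (X t ω) (face B) ≤
    (1 + ∑ i, (Fintype.card (A i) : ℝ)) *
      rate θ (kerDeriv θ 1 - c / 2 * ∑ s ∈ Finset.Icc 1 t, stepSize γ p s)} with hT
  let bad : (Σ i, A i) → Set Ω := fun k => {ω | ∃ t : ℕ,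
    M + c / 8 * ∑ s ∈ Finset.Icc 1 t, stepSize γ p s <
      |∑ s ∈ Finset.Icc 1 t, stepSize γ p s * (V s ω - (P[V s | ℱ s]) ω) k.1 k.2|}
  have hbad : P (⋃ k, bad k) ≤ ENNReal.ofReal δ := by
    calc P (⋃ k, bad k) ≤ ∑ k, P (bad k) := measure_iUnion_fintype_le P bad
      _ ≤ ∑ _k : (Σ i, A i), ENNReal.ofReal (4 * (δ / (4 * (N + 1)))) :=
        Finset.sum_le_sum fun k _ =>
          h.measure_noise_le hγ hM (by positivity) hsum htsum k.1 k.2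
      _ = ENNReal.ofReal (N * (4 * (δ / (4 * (N + 1))))) := by
        rw [Finset.sum_const, Finset.card_univ, nsmul_eq_mul,
          ENNReal.ofReal_mul (Nat.cast_nonneg _), ENNReal.ofReal_natCast]
      _ ≤ ENNReal.ofReal δ := by
        refine ENNReal.ofReal_le_ofReal ?_
        have hN0 : 0 ≤ N := Nat.cast_nonneg _
        have e : N * (4 * (δ / (4 * (N + 1)))) = δ * (N / (N + 1)) := by field_simp
        rw [e]
        exact mul_le_of_le_one_right hδ.le ((div_le_one (by positivity)).2 (by linarith))
  have hoff : ∀ᵐ ω ∂P, ∀ t : ℕ, 1 ≤ t →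
      ‖(P[V t | ℱ t]) ω - payoffVec u (X t ω)‖ ≤ Kb / (t : ℝ) ^ b :=
    ae_all_iff.2 fun t => by
      by_cases ht : 1 ≤ t
      · filter_upwards [h.offset t ht] with ω hω _ using hω
      · exact ae_of_all _ fun ω h1 => absurd h1 ht
  have hsub : Tᶜ ≤ᵐ[P] ⋃ k, bad k := by
    filter_upwards [hoff, hinit] with ω hω hω1 hTω
    by_contra hgood
    replace hgood : ω ∉ ⋃ k, bad k := hgood
    refine hTω ?_
    simp only [bad, mem_iUnion, mem_ofPred_eq, not_exists, not_lt] at hgood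
    have hscore := score_gap_le hB hθ (x := fun t => X t ω) (y := fun t => Y t ω)
      (v := fun t => V t ω) (e := fun t => (P[V t | ℱ t]) ω) hγ hc hη hgap
      (fun t ht => h.aggregate t ht ω) (fun t ht => h.respond t ht ω) hω hR
      (fun i a t => hgood ⟨i, a⟩ t) (fun i a ha b' hb' => (hω1 i a ha b' hb').le)
    rintro t ht
    obtain ⟨t, rfl⟩ : ∃ r, t = r + 1 := ⟨t - 1, by omega⟩
    refine infDist_face_le hB (fun i => (h.respond _ ht ω i).1) (hθ.rate_nonneg _)
      fun i a ha => ?_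
    obtain ⟨b', hb'⟩ := hB i
    refine hθ.apply_le_rate_of_mem_choice (h.respond _ ht ω i)
      (b := b') (by rintro rfl; exact ha hb') ?_
    have h1 := hscore t i a ha b' hb'
    have h2 := mul_le_mul_of_nonneg_left (stepSize_le hγ hp.1 ht) (half_pos hc).le
    have h3 : kerDeriv θ η ≤ kerDeriv θ 1 :=
      hθ.strictMonoOn.monotoneOn hη ⟨one_pos, le_rfl⟩ hη.2
    rw [Finset.sum_Icc_succ_top (by omega)]
    linarith
  have hTc : P Tᶜ ≤ ENNReal.ofReal δ := (measure_mono_ae hsub).trans hbad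
  rw [ENNReal.ofReal_sub _ hδ.le, ENNReal.ofReal_one, tsub_le_iff_right]
  -- Subadditivity is enough, so `T` need not be measurable.
  calc (1 : ENNReal) = P (T ∪ Tᶜ) := by rw [union_compl_self, measure_univ]
    _ ≤ P T + P Tᶜ := measure_union_le _ _
    _ ≤ _ := by gcongr
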